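/- Fix $N\ge 3$, $\Delta>0$, $\sigma_u>0$ and $\Sigma_0>0$. Kyle's equilibrium is the vector $\vec{\hat\beta}=(\hat\beta_1,\dots,\hat\beta_N)'$ which, together with some $(\hat\lambda_n)_{n=1}^N,(\hat\Sigma_n)_{n=0}^N,(\hat\alpha_n)_{n=0}^N$ with $\hat\Sigma_0=\Sigma_0$ and $\hat\alpha_N=0$, solves for $n=1,\dots,N$ $$\lambda_n=\frac{\beta_n\Sigma_{n-1}}{\beta_n^2\Sigma_{n-1}\Delta+\sigma_u^2},\quad \Sigma_n=\frac{\Sigma_{n-1}\sigma_u^2}{\beta_n^2\Sigma_{n-1}\Delta+\sigma_u^2},\quad \alpha_{n-1}=\frac1{4\lambda_n(1-\alpha_n\lambda_n)},\quad \beta_n=\frac{1-2\alpha_n\lambda_n}{2\Delta\lambda_n(1-\alpha_n\lambda_n)},$$ with $\lambda_n\alpha_n<1$ and $\beta_n>0$. For $\vec\beta\in\mathbb R^N$, compute $\lambda_n,\Sigma_n$ ($n=1,\dots,N$) from $\vec\beta$ and $\Sigma_0$ by the first two formulas, forwards in $n$, and then, backwards from $\alpha_N=0$, compute $\alpha_{n-1}$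 for $n=N,\dots,1$ by the third formula. Let $\mathrm{dom}(T)$ be the set of $\vec\beta$ for which $\lambda_n\ne0$ and $1-\alpha_n\lambda_n\neq0$ for all $n$, and for $\vec\beta\in\mathrm{dom}(T)$ let $T(\vec\beta)$ be the vector of the right-hand sides of the fourth formula. The policy iterations $\vec\beta^{(m+1)}=T(\vec\beta^{(m)})$ started at $\vec\beta^{(0)}$ are said to converge to $\vec{\hat\beta}$ if $\vec\beta^{(m)}\in\mathrm{dom}(T)$ for all $m\ge 0$ and $\lim_{m\to\infty}\vec\beta^{(m)}=\vec{\hat\beta}$. Kyle's equilibrium is called unstable if $\vec{\hat\beta}$ is the only starting policy $\vec\beta^{(0)}\in(0,\infty)^N$ whose policy iterations converge to $\vec{\hat\beta}$. **Theorem.** Kyle's equilibrium $\vec{\hat\beta}$ exists, is unique, and is not unstable with respect to policy iterations. Moreover, this already holds for marginal perturbations: for every $\epsilon>0$ there is a starting policy $\vec\beta^{(0)}\in(0,\infty)^N$ with $0<|\vec\beta^{(0)}-\vec{\hat\beta}|<\epsilon$ whose policy iterations converge to $\vec{\hat\beta}$. -/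

import Mathlib

open Filter Topology

/-- Input parameters of Kyle's discrete-time model: the time step `Δ`, the noise-trading
volatility `σ` (noise orders have variance `σ ^ 2 * Δ`), and the variance `V₀ = Σ_0` of the
liquidating value. -/
structure KyleParams where
  Δ : ℝ
  σ : ℝ
  V₀ : ℝ
  Δ_pos : 0 < Δ
  σ_pos : 0 < σ
  V₀_pos : 0 < V₀

namespace KyleParams

variable (p : KyleParams) {N : ℕ}

/-- Kyle's system for `(λ, Σ, α, β)` with `N` trading times. The trading time `n ∈ {1, …, N}` is the
index `i : Fin N` with `n = i + 1`; `lam i`, `β i` stand for `λ_n`, `β_n`, while `Sig`, `alp` are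
indexed by `{0, …, N}`, with `i.castSucc`, `i.succ` standing for `n - 1`, `n`. Kyle's equilibrium has
positive trading intensities (without a sign requirement `(-λ, Σ, -α, -β)` is a second solution);
positivity of `β` also makes all `λ_n` positive and all denominators nonzero. -/
structure IsKyleSolution (lam : Fin N → ℝ) (Sig alp : Fin (N + 1) → ℝ)
    (β : EuclideanSpace ℝ (Fin N)) : Prop where
  Sig_zero : Sig 0 = p.V₀
  alp_last : alp (Fin.last N) = 0
  lam_eq : ∀ i : Fin N,
    lam i = β i * Sig i.castSucc / (β i ^ 2 * Sig i.castSucc * p.Δ + p.σ ^ 2)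
  Sig_succ : ∀ i : Fin N,
    Sig i.succ = Sig i.castSucc * p.σ ^ 2 / (β i ^ 2 * Sig i.castSucc * p.Δ + p.σ ^ 2)
  alp_castSucc : ∀ i : Fin N,
    alp i.castSucc = 1 / (4 * lam i * (1 - alp i.succ * lam i))
  β_eq : ∀ i : Fin N,
    β i = (1 - 2 * alp i.succ * lam i) / (p.Δ * 2 * lam i * (1 - alp i.succ * lam i))
  second_order : ∀ i : Fin N, lam i * alp i.succ < 1
  β_pos : ∀ i : Fin N, 0 < β i

/-- `β` is the insider's vector of trading intensities in Kyle's linear equilibrium. -/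
def IsKyleEquilibrium (β : EuclideanSpace ℝ (Fin N)) : Prop :=
  ∃ (lam : Fin N → ℝ) (Sig alp : Fin (N + 1) → ℝ), p.IsKyleSolution lam Sig alp β

/-- The conditional variances `Σ_0, …, Σ_N` produced by the policy `β` (forward recursion). -/
noncomputable def condVar (β : EuclideanSpace ℝ (Fin N)) : Fin (N + 1) → ℝ :=
  Fin.induction p.V₀ fun i S => S * p.σ ^ 2 / (β i ^ 2 * S * p.Δ + p.σ ^ 2)

/-- The market makers' pricing coefficients `λ_1, …, λ_N` in response to the policy `β`. -/
noncomputable def kyleLambda (β : EuclideanSpace ℝ (Fin N)) (i : Fin N) : ℝ :=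
  β i * p.condVar β i.castSucc / (β i ^ 2 * p.condVar β i.castSucc * p.Δ + p.σ ^ 2)

/-- The coefficients `α_0, …, α_N` of the insider's problem when she faces the pricing
coefficients `kyleLambda β` (backward recursion started from `α_N = 0`). -/
noncomputable def alpha (β : EuclideanSpace ℝ (Fin N)) : Fin (N + 1) → ℝ :=
  Fin.reverseInduction (motive := fun _ => ℝ) 0
    fun i a => 1 / (4 * p.kyleLambda β i * (1 - a * p.kyleLambda β i))

/-- The domain of the policy iteration map: all denominators occurring in the insider's response
are nonzero. -/
def dom (N : ℕ) : Set (EuclideanSpace ℝ (Fin N)) :=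
  {β | ∀ i : Fin N,
    p.kyleLambda β i ≠ 0 ∧ 1 - p.alpha β i.succ * p.kyleLambda β i ≠ 0}

/-- The policy iteration map `T`; its values are meaningful on `dom` only. -/
noncomputable def T (β : EuclideanSpace ℝ (Fin N)) : EuclideanSpace ℝ (Fin N) :=
  WithLp.toLp 2 fun i =>
    (1 - 2 * p.alpha β i.succ * p.kyleLambda β i) /
      (p.Δ * 2 * p.kyleLambda β i * (1 - p.alpha β i.succ * p.kyleLambda β i))

/-- The policy iterations `β⁽ᵐ⁺¹⁾ = T(β⁽ᵐ⁾)` started at `β₀` converge to `βhat`. An iterate outside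
the domain is sent to `(∞, …, ∞)`, from where there is no return, so that convergence requires all
iterates to lie in the domain. -/
def IterationsConverge (β₀ βhat : EuclideanSpace ℝ (Fin N)) : Prop :=
  (∀ m : ℕ, p.T^[m] β₀ ∈ p.dom N) ∧ Tendsto (fun m : ℕ => p.T^[m] β₀) atTop (𝓝 βhat)

/-- `βhat` is unstable with respect to policy iterations: `βhat` is the only starting policy, in
`(0, ∞) ^ N`, from which the policy iterations converge to `βhat`. -/
def IsUnstable (βhat : EuclideanSpace ℝ (Fin N)) : Prop :=
  ∀ β₀ : EuclideanSpace ℝ (Fin N),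
    (∀ i, 0 < β₀ i) → p.IterationsConverge β₀ βhat → β₀ = βhat

end KyleParams

/-! The last intensity `β_N` enters `T` only through `λ_N`, and the equilibrium value of `β_N`
maximizes `λ_N`. Scaling it by `c` or by `c⁻¹` therefore gives the same image under `T`, so `T` is
not injective near the equilibrium and its derivative `A` there has a nontrivial kernel
(`T_scale_last`, `derivative_not_injective`). However expanding `A` may be in other directions, a
kernel vector suffices: some power `A ^ k` vanishes on a nonzero subspace and is invertible on a
complement. As in the strong stable manifold theorem, a contraction argument on weighted sequences
yields orbits of `T^[k]` that start off the equilibrium and decay geometrically to it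
(`exists_decaying_orbit`, `exists_convergent_orbit_of_not_injective`). Existence and uniqueness rest
on the ratios `q_n = α_n λ_n`. They satisfy a backward recursion from `q_N = 0`, each step a cubic
with exactly one root in `[0, 1/2)`. The ratios determine `Σ`, then `λ > 0` through its square, then
`β`. -/

section StrongStable

/-! ### Convergent orbits at a fixed point with non-injective derivative -/

variable {E : Type*} [NormedAddCommGroup E] [NormedSpace ℝ E]

/-- Fitting decomposition: for a non-injective `A`, some power `A ^ k` splits the space into its
kernel, with projection `P`, and a complement on which `C` is its inverse. -/
lemma exists_fitting_inverse [FiniteDimensional ℝ E] (A : E →L[ℝ] E)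
    (hA : ¬ Function.Injective A) :
    ∃ (k : ℕ) (P C : E →L[ℝ] E) (ξ : E), k ≠ 0 ∧ ξ ≠ 0 ∧ P ξ = ξ ∧ (∀ x, P (P x) = P x) ∧
      (∀ x, (A ^ k) (P x) = 0) ∧ (∀ x, P (C x) = 0) ∧ ∀ x, (A ^ k) (C x) = x - P x := by
  let f : Module.End ℝ E := A.toLinearMap
  obtain ⟨k, hk, hk0⟩ := ((LinearMap.eventually_isCompl_ker_pow_range_pow f).and
    (eventually_ne_atTop 0)).exists
  have hpow : ∀ n x, (A ^ n) x = (f ^ n) x := by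
    intro n
    induction n with
    | zero => intro x; rfl
    | succ n ih => intro x; rw [pow_succ, pow_succ]; exact ih (A x)
  set M : Module.End ℝ E := f ^ k with hM
  let P : E →ₗ[ℝ] E := (LinearMap.ker M).projection (LinearMap.range M) hk
  have hPmem : ∀ x, M (P x) = 0 := fun x => Submodule.projection_apply_mem hk x
  have hPl : ∀ x, M x = 0 → P x = x := fun x hx =>
    Submodule.projection_apply_of_mem_left hk (LinearMap.mem_ker.2 hx)
  have hPr : ∀ x, P (M x) = 0 := fun x =>
    (Submodule.projection_apply_eq_zero_iff hk).2 ⟨x, rfl⟩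
  -- `M + P` is block diagonal: the identity on the kernel of `M`, and `M` itself, injective there,
  -- on the range. Its inverse after `1 - P` is `C`.
  have hinj : Function.Injective (M + P) := by
    rw [injective_iff_map_eq_zero]
    intro x hx
    have h1 : M x + P x = 0 := hx
    have h2 : P x = 0 := by
      have := congrArg P h1
      rwa [map_add, hPr, zero_add, map_zero, hPl _ (hPmem x)] at this
    rw [h2, add_zero] at h1
    rw [← hPl x h1, h2]
  let D := LinearEquiv.ofInjectiveEndo (M + P) hinj
  have hD : ∀ y, M (D.symm y) + P (D.symm y) = y := fun y => D.apply_symm_apply y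
  have hPD : ∀ y, P (D.symm y) = P y := by
    intro y
    have := congrArg P (hD y)
    rwa [map_add, hPr, zero_add, hPl _ (hPmem _)] at this
  let C : E →ₗ[ℝ] E := D.symm.toLinearMap ∘ₗ (LinearMap.id - P)
  have hC : ∀ x, C x = D.symm (x - P x) := fun x => rfl
  have hPC : ∀ x, P (C x) = 0 := by
    intro x
    rw [hC, hPD, map_sub, hPl _ (hPmem _), sub_self]
  obtain ⟨ξ, hξ0, hξ⟩ : ∃ ξ : E, ξ ≠ 0 ∧ A ξ = 0 := by
    by_contra! h
    exact hA ((injective_iff_map_eq_zero A).2 fun a ha => by_contra fun h' => h a h' ha)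
  refine ⟨k, LinearMap.toContinuousLinearMap P, LinearMap.toContinuousLinearMap C, ξ, hk0, hξ0,
    ?_, ?_, ?_, ?_, ?_⟩
  · refine hPl ξ ?_
    obtain ⟨j, rfl⟩ := Nat.exists_eq_succ_of_ne_zero hk0
    rw [hM, ← hpow, pow_succ]
    change (A ^ j) (A ξ) = 0
    rw [hξ, map_zero]
  · exact fun x => hPl _ (hPmem x)
  · exact fun x => (hpow k _).trans (hPmem x)
  · exact hPC
  · intro x
    refine (hpow k _).trans ?_
    have h := hD (x - P x)
    rw [← hC, hPC, add_zero] at h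
    exact h

/-- A perturbation `M + r` of a linear map `M` that vanishes on the range of `P` and has inverse `C`
on the complement possesses orbits decaying like `ρ ^ m`, with prescribed `P`-component of the
initial point. -/
lemma exists_decaying_orbit [CompleteSpace E] {M P C : E →L[ℝ] E} {r : E → E} {η δ ρ : ℝ} {ξ : E}
    (hPP : ∀ x, P (P x) = P x) (hMP : ∀ x, M (P x) = 0) (hPC : ∀ x, P (C x) = 0)
    (hMC : ∀ x, M (C x) = x - P x) (hPξ : P ξ = ξ) (hξ : ‖ξ‖ ≤ η / 2) (hr0 : r 0 = 0)
    (hr : ∀ x y, ‖x‖ ≤ η → ‖y‖ ≤ η → ‖r x - r y‖ ≤ δ * ‖x - y‖)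
    (hρ : 0 < ρ) (hρ1 : ρ ≤ 1) (hδ : 0 ≤ δ)
    (hsmall : ‖C‖ * (ρ + δ) + ρ⁻¹ * (‖P‖ * δ) ≤ 1 / 2) :
    ∃ u : ℕ → E, P (u 0) = ξ ∧ (∀ m, ‖u m‖ ≤ ρ ^ m * η) ∧ ∀ m, u (m + 1) = M (u m) + r (u m) := by
  have hη : 0 ≤ η := by linarith [norm_nonneg ξ]
  have hρm : ∀ m : ℕ, 0 < ρ ^ m := fun m => pow_pos hρ m
  -- Substitute `u m = ρ ^ m • w m`. Since `ρ ≤ 1`, the rescaled remainder keeps the Lipschitz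
  -- constant `δ` on the ball of radius `η`.
  let R : ℕ → E → E := fun m w => (ρ ^ m)⁻¹ • r (ρ ^ m • w)
  have hRs : ∀ m w, ρ ^ m • R m w = r (ρ ^ m • w) := fun m w => smul_inv_smul₀ (hρm m).ne' _
  have hR0 : ∀ m, R m 0 = 0 := fun m => by simp [R, hr0]
  have hball : ∀ (m : ℕ) (w : E), ‖w‖ ≤ η → ‖ρ ^ m • w‖ ≤ η := fun m w hw => by
    rw [norm_smul, Real.norm_of_nonneg (hρm m).le]
    exact (mul_le_of_le_one_left (norm_nonneg _) (pow_le_one₀ hρ.le hρ1)).trans hw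
  have hR : ∀ m w w', ‖w‖ ≤ η → ‖w'‖ ≤ η → ‖R m w - R m w'‖ ≤ δ * ‖w - w'‖ := by
    intro m w w' hw hw'
    have h := hr _ _ (hball m w hw) (hball m w' hw')
    rw [← smul_sub, norm_smul, Real.norm_of_nonneg (hρm m).le] at h
    simp only [R]
    rw [← smul_sub, norm_smul, norm_inv, Real.norm_of_nonneg (hρm m).le,
      inv_mul_le_iff₀ (hρm m)]
    linarith
  -- The orbit equation reads `ρ • w (m + 1) = M (w m) + R m (w m)`. Its `P`-part determines `P (w
  -- m)` from the previous term (`b`, with `ξ` at time 0); the complementary part is solved for `w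
  -- m` from the next term by means of `C`.
  let b : (ℕ → E) → ℕ → E := fun w m =>
    Nat.casesOn m ξ fun j => ρ⁻¹ • P (R j (w j))
  let Φ : (ℕ → E) → ℕ → E := fun w m => C (ρ • w (m + 1) - R m (w m)) + b w m
  have hb : ∀ (w w' : ℕ → E) (d : ℝ), (∀ j, ‖w j‖ ≤ η) → (∀ j, ‖w' j‖ ≤ η) →
      (∀ j, ‖w j - w' j‖ ≤ d) → ∀ m, ‖b w m - b w' m‖ ≤ ρ⁻¹ * (‖P‖ * δ) * d := by
    intro w w' d hw hw' hd m
    have hd0 : 0 ≤ d := (norm_nonneg _).trans (hd 0)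
    cases m with
    | zero =>
      have h0 : b w 0 - b w' 0 = 0 := sub_self ξ
      rw [h0, norm_zero]
      positivity
    | succ j =>
      simp only [b]
      rw [← smul_sub, ← map_sub, norm_smul, norm_inv, Real.norm_of_nonneg hρ.le, mul_assoc]
      gcongr
      refine (P.le_opNorm _).trans ?_
      rw [mul_assoc]
      gcongr
      exact (hR _ _ _ (hw j) (hw' j)).trans (by gcongr; exact hd j)
  have hΦ : ∀ (w w' : ℕ → E) (d : ℝ), (∀ j, ‖w j‖ ≤ η) → (∀ j, ‖w' j‖ ≤ η) →
      (∀ j, ‖w j - w' j‖ ≤ d) → ∀ m, ‖Φ w m - Φ w' m‖ ≤ 1 / 2 * d := by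
    intro w w' d hw hw' hd m
    have hd0 : 0 ≤ d := (norm_nonneg _).trans (hd 0)
    have h1 : ‖C (ρ • w (m + 1) - R m (w m)) - C (ρ • w' (m + 1) - R m (w' m))‖ ≤
        ‖C‖ * (ρ + δ) * d := by
      rw [← map_sub, mul_assoc]
      refine (C.le_opNorm _).trans ?_
      gcongr
      have e : ρ • w (m + 1) - R m (w m) - (ρ • w' (m + 1) - R m (w' m)) =
          ρ • (w (m + 1) - w' (m + 1)) - (R m (w m) - R m (w' m)) := by
        rw [smul_sub]; abel
      rw [e, add_mul]
      refine (norm_sub_le _ _).trans (add_le_add ?_ ?_)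
      · rw [norm_smul, Real.norm_of_nonneg hρ.le]
        gcongr
        exact hd _
      · exact (hR _ _ _ (hw _) (hw' _)).trans (by gcongr; exact hd _)
    have e : Φ w m - Φ w' m = (C (ρ • w (m + 1) - R m (w m)) -
        C (ρ • w' (m + 1) - R m (w' m))) + (b w m - b w' m) := by
      simp only [Φ]; abel
    rw [e]
    refine (norm_add_le _ _).trans ((add_le_add h1 (hb w w' d hw hw' hd m)).trans ?_)
    rw [← add_mul]
    gcongr
  have hΦ0 : ∀ m, ‖Φ 0 m‖ ≤ η / 2 := by
    intro m
    cases m with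
    | zero => simpa [Φ, b, hR0] using hξ
    | succ j => simp only [Φ, b, Pi.zero_apply, hR0, map_zero, smul_zero, sub_zero, add_zero,
        norm_zero]; positivity
  -- `‖Φ 0‖ ≤ η / 2` and the contraction factor `1 / 2` together keep the ball of radius `η`
  -- invariant.
  have hΦball : ∀ w : ℕ → E, (∀ j, ‖w j‖ ≤ η) → ∀ m, ‖Φ w m‖ ≤ η := by
    intro w hw m
    have h := hΦ w 0 η hw (fun j => by simpa using hη) (fun j => by simpa using hw j) m
    have h2 := norm_le_norm_add_norm_sub' (Φ w m) (Φ 0 m)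
    linarith [hΦ0 m]
  let X := BoundedContinuousFunction ℕ (Metric.closedBall (0 : E) η)
  have : Nonempty (Metric.closedBall (0 : E) η) := ⟨⟨0, by simpa using hη⟩⟩
  have : CompleteSpace (Metric.closedBall (0 : E) η) :=
    Metric.isClosed_closedBall.completeSpace_coe
  have hX : ∀ (w : X) j, ‖(w j : E)‖ ≤ η := fun w j => mem_closedBall_zero_iff.1 (w j).2
  let Ψ : X → X := fun w => BoundedContinuousFunction.mkOfDiscrete
    (fun m => ⟨Φ (fun j => (w j : E)) m, by simpa using hΦball _ (hX w) m⟩) (η + η) (by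
      intro x y
      rw [Subtype.dist_eq, dist_eq_norm]
      exact (norm_sub_le _ _).trans (add_le_add (hΦball _ (hX w) _) (hΦball _ (hX w) _)))
  have hΨ : ∀ (w : X) m, ((Ψ w) m : E) = Φ (fun j => (w j : E)) m := fun w m => rfl
  have : Nonempty X := ⟨BoundedContinuousFunction.const ℕ (Classical.arbitrary _)⟩
  have hcontr : ContractingWith (1 / 2) Ψ := by
    refine ⟨by norm_num, LipschitzWith.of_dist_le_mul fun w w' => ?_⟩
    refine (BoundedContinuousFunction.dist_le (by positivity)).2 fun m => ?_
    rw [Subtype.dist_eq, dist_eq_norm, hΨ, hΨ]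
    have := hΦ _ _ (dist w w') (hX w) (hX w') (fun j => by
      rw [← dist_eq_norm, ← Subtype.dist_eq]
      exact BoundedContinuousFunction.dist_coe_le_dist j) m
    simpa using this
  let w : X := ContractingWith.fixedPoint Ψ hcontr
  have hw : Ψ w = w := hcontr.fixedPoint_isFixedPt
  have hwm : ∀ m, (w m : E) = C (ρ • (w (m + 1) : E) - R m (w m)) +
      b (fun j => (w j : E)) m := by
    intro m
    conv_lhs => rw [← hw]
    rfl
  have hPb : ∀ m, P (b (fun j => (w j : E)) m) = b (fun j => (w j : E)) m := by
    intro m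
    cases m with
    | zero => exact hPξ
    | succ j => simp only [b, map_smul, hPP]
  have hPw : ∀ m, P (w m : E) = b (fun j => (w j : E)) m := by
    intro m
    rw [hwm m, map_add, hPC, zero_add, hPb]
  refine ⟨fun m => ρ ^ m • (w m : E), ?_, ?_, ?_⟩
  · simpa [b] using hPw 0
  · intro m
    rw [norm_smul, Real.norm_of_nonneg (hρm m).le]
    exact mul_le_mul_of_nonneg_left (hX w m) (hρm m).le
  · intro m
    have hMw : M (w m : E) = (ρ • (w (m + 1) : E) - R m (w m)) -
        P (ρ • (w (m + 1) : E) - R m (w m)) := by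
      conv_lhs => rw [hwm m]
      rw [map_add, ← hPb, hMP, add_zero, hMC]
    have hPw1 : ρ • P (w (m + 1) : E) = P (R m (w m)) := by
      rw [hPw (m + 1)]
      exact smul_inv_smul₀ hρ.ne' _
    have hfin : ρ • (w (m + 1) : E) = M (w m) + R m (w m) := by
      rw [hMw, map_sub, map_smul, hPw1]; abel
    change ρ ^ (m + 1) • (w (m + 1) : E) = M (ρ ^ m • (w m : E)) + r (ρ ^ m • (w m : E))
    rw [← hRs, map_smul, ← smul_add, ← hfin, smul_smul, pow_succ]

/-- A map whose derivative at a fixed point is not injective has points arbitrarily close to, but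
different from, the fixed point whose orbits stay close to it and converge to it. -/
theorem exists_convergent_orbit_of_not_injective [FiniteDimensional ℝ E] {f : E → E}
    {A : E →L[ℝ] E} {a : E} (hf : HasStrictFDerivAt f A a) (hfa : f a = a)
    (hA : ¬ Function.Injective A) {U : Set E} (hU : U ∈ 𝓝 a) :
    ∃ z, z ≠ a ∧ (∀ m : ℕ, f^[m] z ∈ U) ∧ Tendsto (fun m : ℕ => f^[m] z) atTop (𝓝 a) := by
  have : CompleteSpace E := FiniteDimensional.complete ℝ E
  obtain ⟨k, P, C, ξ, hk, hξ0, hPξ, hPP, hMP, hPC, hMC⟩ := exists_fitting_inverse A hA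
  have hit : ∀ n, f^[n] a = a := fun n => Function.iterate_fixed hfa n
  -- The decaying orbit will be one of `f^[k]`; the `j < k` intermediate iterates are controlled by
  -- continuity.
  have hnear : ∀ W ∈ 𝓝 a, ∀ᶠ y in 𝓝 a, ∀ j < k, f^[j] y ∈ W := by
    intro W hW
    have : ∀ j ∈ Finset.range k, ∀ᶠ y in 𝓝 a, f^[j] y ∈ W := by
      intro j _
      have hc := (hf.iterate hfa j).continuousAt
      rw [ContinuousAt, hit] at hc
      exact hc hW
    filter_upwards [(Finset.eventually_all _).2 this] with y hy j hj using
      hy j (Finset.mem_range.2 hj)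
  have hsplit : ∀ z m, f^[m] z = f^[m % k] ((f^[k])^[m / k] z) := by
    intro z m
    rw [← Function.iterate_mul, ← Function.iterate_add_apply, Nat.mod_add_div]
  have hG : HasStrictFDerivAt f^[k] (A ^ k) a := hf.iterate hfa k
  -- `ρ` and then `δ`, which depends on `ρ⁻¹`, each contribute at most `1 / 4` to the contraction
  -- constant `1 / 2`.
  obtain ⟨ρ, hρ, hρ1, hρC⟩ : ∃ ρ : ℝ, 0 < ρ ∧ ρ < 1 ∧ ‖C‖ * ρ ≤ 1 / 4 := by
    refine ⟨1 / (4 * (‖C‖ + 1)), by positivity, ?_, ?_⟩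
    · rw [div_lt_one (by positivity)]; linarith [norm_nonneg C]
    · rw [mul_one_div, div_le_div_iff₀ (by positivity) (by positivity)]; linarith [norm_nonneg C]
  obtain ⟨δ, hδ, hδs⟩ : ∃ δ : ℝ, 0 < δ ∧ (‖C‖ + ρ⁻¹ * ‖P‖) * δ ≤ 1 / 4 := by
    refine ⟨1 / (4 * ((‖C‖ + ρ⁻¹ * ‖P‖) + 1)), by positivity, ?_⟩
    have : 0 ≤ ‖C‖ + ρ⁻¹ * ‖P‖ := by positivity
    rw [mul_one_div, div_le_div_iff₀ (by positivity) (by positivity)]; linarith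
  have hlip : ∀ᶠ q : E × E in 𝓝 (a, a),
      ‖f^[k] q.1 - f^[k] q.2 - (A ^ k) (q.1 - q.2)‖ ≤ δ * ‖q.1 - q.2‖ := hG.isLittleO.def hδ
  rw [nhds_prod_eq, eventually_prod_self_iff'] at hlip
  obtain ⟨V, hV, hVlip⟩ := hlip
  obtain ⟨η, hη, hηs⟩ := Metric.nhds_basis_closedBall.mem_iff.1
    (inter_mem hV (hnear U hU))
  have hmem : ∀ x, ‖x‖ ≤ η → a + x ∈ Metric.closedBall a η := fun x hx => by simpa using hx
  let r : E → E := fun x => f^[k] (a + x) - a - (A ^ k) x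
  let t : ℝ := η / 2 / ‖ξ‖
  have ht : 0 < t := by have := norm_pos_iff.2 hξ0; positivity
  obtain ⟨u, hu0, hub, hus⟩ := exists_decaying_orbit (M := A ^ k) (P := P) (C := C) (r := r)
    (η := η) (δ := δ) (ρ := ρ) (ξ := t • ξ) hPP hMP hPC hMC (by rw [map_smul, hPξ])
    (by rw [norm_smul, Real.norm_of_nonneg ht.le, div_mul_cancel₀ _ (norm_ne_zero_iff.2 hξ0)])
    (by simp [r, hit]) (by
      intro x y hx hy
      have h := hVlip _ (hηs (hmem x hx)).1 _ (hηs (hmem y hy)).1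
      simp only [add_sub_add_left_eq_sub] at h
      convert h using 2
      simp only [r, map_sub]
      abel) hρ hρ1.le hδ.le (by nlinarith)
  have horb : ∀ n, (f^[k])^[n] (a + u 0) = a + u n := by
    intro n
    induction n with
    | zero => rfl
    | succ n ih =>
      rw [Function.iterate_succ_apply', ih, hus]
      simp only [r]
      abel
  have huη : ∀ n, ‖u n‖ ≤ η := fun n =>
    (hub n).trans (mul_le_of_le_one_left hη.le (pow_le_one₀ hρ.le hρ1.le))
  have hu : Tendsto (fun n => a + u n) atTop (𝓝 a) := by
    have h0 : Tendsto (fun n => ρ ^ n * η) atTop (𝓝 0) := by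
      simpa using (tendsto_pow_atTop_nhds_zero_of_lt_one hρ.le hρ1).mul_const η
    simpa using (squeeze_zero_norm hub h0).const_add a
  refine ⟨a + u 0, ?_, ?_, ?_⟩
  -- The prescribed component `P (u 0) = t • ξ` is nonzero.
  · intro h
    have h0 : u 0 = 0 := by simpa using h
    rw [h0, map_zero] at hu0
    exact (smul_ne_zero ht.ne' hξ0) hu0.symm
  · intro m
    rw [hsplit, horb]
    exact (hηs (hmem _ (huη _))).2 _ (Nat.mod_lt _ (Nat.pos_of_ne_zero hk))
  · rw [tendsto_def]
    intro W hW
    have h1 := (hu.eventually (hnear W hW))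
    have h2 : Tendsto (fun m : ℕ => m / k) atTop atTop :=
      Nat.tendsto_div_const_atTop hk
    filter_upwards [h2.eventually h1] with m hm
    rw [Set.mem_preimage, hsplit, horb]
    exact hm _ (Nat.mod_lt _ (Nat.pos_of_ne_zero hk))

end StrongStable

/-! ### Existence and uniqueness of the equilibrium -/

namespace KyleParams

variable (p : KyleParams) {N : ℕ}

/-- Intermediate values: left minus right is `-1` at `0` and `c > 0` at `1 / 2`. In the application
`x = α_n λ_n` and `c = 1 - 2 α_{n+1} λ_{n+1}`. -/
lemma exists_cubic_root {c : ℝ} (hc : 0 < c) :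
    ∃ x : ℝ, 0 ≤ x ∧ x < 1 / 2 ∧ 8 * x ^ 2 * c * (1 - x) = 1 - 2 * x := by
  have hcont : ContinuousOn (fun x : ℝ => 8 * x ^ 2 * c * (1 - x) - (1 - 2 * x))
      (Set.Icc 0 (1 / 2)) := by fun_prop
  obtain ⟨x, hx, hx0⟩ := intermediate_value_Icc (by norm_num) hcont
    (show (0 : ℝ) ∈ Set.Icc _ _ from ⟨by norm_num, by norm_num; linarith⟩)
  have h0 : 8 * x ^ 2 * c * (1 - x) - (1 - 2 * x) = 0 := hx0
  refine ⟨x, hx.1, lt_of_le_of_ne hx.2 fun h => ?_, by linarith⟩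
  rw [h] at h0
  linarith

/-- On `[0, 1/2)` the left side of the cubic increases while the right side strictly decreases. Used
in both directions, this gives uniqueness of the root. -/
lemma cubic_root_le {c x y : ℝ} (hc : 0 < c) (hx : 0 ≤ x) (hy : y < 1 / 2)
    (hxc : 8 * x ^ 2 * c * (1 - x) = 1 - 2 * x) (hyc : 8 * y ^ 2 * c * (1 - y) = 1 - 2 * y) :
    y ≤ x := by
  by_contra! h
  have h1 : 0 ≤ (y - x) * ((y + x) - (y ^ 2 + x * y + x ^ 2)) := by
    apply mul_nonneg (by linarith)
    nlinarith
  have h2 : 8 * x ^ 2 * c * (1 - x) ≤ 8 * y ^ 2 * c * (1 - y) := by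
    nlinarith [mul_nonneg hc.le h1]
  linarith

lemma exists_backward_ratios (N : ℕ) : ∃ q : Fin (N + 1) → ℝ, q (Fin.last N) = 0 ∧
    (∀ n, 0 ≤ q n ∧ q n < 1 / 2) ∧
    ∀ i : Fin N, 8 * q i.castSucc ^ 2 * (1 - 2 * q i.succ) * (1 - q i.castSucc) =
      1 - 2 * q i.castSucc := by
  have hex : ∀ y : ℝ, ∃ x : ℝ, y < 1 / 2 → 0 ≤ x ∧ x < 1 / 2 ∧
      8 * x ^ 2 * (1 - 2 * y) * (1 - x) = 1 - 2 * x := by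
    intro y
    by_cases hy : y < 1 / 2
    · obtain ⟨x, hx⟩ := exists_cubic_root (show 0 < 1 - 2 * y by linarith)
      exact ⟨x, fun _ => hx⟩
    · exact ⟨0, fun h => absurd h hy⟩
  choose h hh using hex
  let q : Fin (N + 1) → ℝ := Fin.reverseInduction (motive := fun _ => ℝ) 0 fun _ y => h y
  have hlast : q (Fin.last N) = 0 := Fin.reverseInduction_last ..
  have hstep : ∀ i : Fin N, q i.castSucc = h (q i.succ) :=
    fun i => Fin.reverseInduction_castSucc ..
  have hq : ∀ n, 0 ≤ q n ∧ q n < 1 / 2 := by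
    intro n
    induction n using Fin.reverseInduction with
    | last => rw [hlast]; norm_num
    | cast i ih =>
      rw [hstep]
      exact ⟨(hh _ ih.2).1, (hh _ ih.2).2.1⟩
  refine ⟨q, hlast, hq, fun i => ?_⟩
  rw [hstep i]
  exact (hh _ (hq _).2).2.2

/-- Kyle's system has a solution. -/
theorem exists_isKyleEquilibrium (N : ℕ) :
    ∃ β : EuclideanSpace ℝ (Fin N), p.IsKyleEquilibrium β := by
  obtain ⟨q, hlast, hq, hrel⟩ := exists_backward_ratios N
  have hΔ := p.Δ_pos
  have hσ := p.σ_pos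
  let S : Fin (N + 1) → ℝ := Fin.induction p.V₀ fun i s => s / (2 * (1 - q i.succ))
  have hS0 : S 0 = p.V₀ := rfl
  have hSs : ∀ i : Fin N, S i.succ = S i.castSucc / (2 * (1 - q i.succ)) :=
    fun i => Fin.induction_succ ..
  have hq1 : ∀ n, 0 < 1 - q n := fun n => by linarith [(hq n).2]
  have hq2 : ∀ n, 0 < 1 - 2 * q n := fun n => by linarith [(hq n).2]
  have hSpos : ∀ n, 0 < S n := by
    intro n
    induction n using Fin.induction with
    | zero => exact p.V₀_pos
    | succ i ih =>
      rw [hSs]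
      have := hq1 i.succ
      positivity
  -- The value of `λ_n` forced by `lam_sq`, written with `Σ_n`. The index `0` has no price
  -- coefficient; `l 0` and `q 0` serve only to represent `α_0` as `q 0 / l 0`.
  let l : Fin (N + 1) → ℝ := fun n =>
    √((1 - 2 * q n) * S n / (2 * (1 - q n) * (p.Δ * p.σ ^ 2)))
  have hlarg : ∀ n, 0 < (1 - 2 * q n) * S n / (2 * (1 - q n) * (p.Δ * p.σ ^ 2)) := by
    intro n
    have := hq1 n
    have := hq2 n
    have := hSpos n
    positivity
  have hl : ∀ n, 0 < l n := fun n => Real.sqrt_pos.2 (hlarg n)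
  have hl2 : ∀ n, l n ^ 2 * (2 * (1 - q n) * (p.Δ * p.σ ^ 2)) = (1 - 2 * q n) * S n := by
    intro n
    have := hq1 n
    rw [Real.sq_sqrt (hlarg n).le]
    field_simp
  have hSc : ∀ i : Fin N, S i.castSucc = 2 * (1 - q i.succ) * S i.succ := by
    intro i
    have := (hq1 i.succ).ne'
    rw [hSs]
    field_simp
  have hal : ∀ n, q n / l n * l n = q n := fun n => div_mul_cancel₀ _ (hl n).ne'
  have hβ : ∀ i : Fin N, ((1 - 2 * q i.succ) / (2 * p.Δ * l i.succ * (1 - q i.succ))) ^ 2 *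
      S i.castSucc * p.Δ + p.σ ^ 2 = 2 * (1 - q i.succ) * p.σ ^ 2 := by
    intro i
    have h1 := (hq1 i.succ).ne'
    have h2 := (hl i.succ).ne'
    have h3 := hl2 i.succ
    rw [hSc]
    field_simp
    linear_combination (-(1 - 2 * q i.succ)) * h3
  refine ⟨WithLp.toLp 2 fun i => (1 - 2 * q i.succ) / (2 * p.Δ * l i.succ * (1 - q i.succ)),
    fun i => l i.succ, S, fun n => q n / l n, hS0, ?_, ?_, ?_, ?_, ?_, ?_, ?_⟩
  · simp only [hlast, zero_div]
  · intro i
    have h1 := (hq1 i.succ).ne'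
    have h2 := (hl i.succ).ne'
    have h3 := hl2 i.succ
    simp only
    rw [hβ, hSc]
    field_simp
    linear_combination h3
  · intro i
    have h1 := (hq1 i.succ).ne'
    simp only
    rw [hβ, hSs]
    field_simp
  · intro i
    have h1 := hq1 i.succ
    have h1' := hq1 i.castSucc
    have h2 := hl i.succ
    have h2' := hl i.castSucc
    rw [hal]
    -- This is the recursion for `α` in terms of the ratios; after squaring it becomes the cubic
    -- relation `hrel`.
    have key : l i.castSucc = 4 * q i.castSucc * (1 - q i.succ) * l i.succ := by
      have hnn : 0 ≤ 4 * q i.castSucc * (1 - q i.succ) * l i.succ := by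
        have := (hq i.castSucc).1
        positivity
      refine (pow_left_inj₀ h2'.le hnn two_ne_zero).1 ?_
      have e1 := hl2 i.succ
      have e2 := hl2 i.castSucc
      have e3 := hrel i
      rw [hSc] at e2
      have hK : 2 * (1 - q i.castSucc) * (p.Δ * p.σ ^ 2) ≠ 0 := by positivity
      refine mul_right_cancel₀ hK ?_
      linear_combination e2 - 16 * q i.castSucc ^ 2 * (1 - q i.succ) * (1 - q i.castSucc) * e1
        - 2 * (1 - q i.succ) * S i.succ * e3
    rw [div_eq_div_iff h2'.ne' (by positivity)]
    linear_combination -key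
  · intro i
    have h1 := (hq1 i.succ).ne'
    have h2 := (hl i.succ).ne'
    simp only
    have e : 2 * (q i.succ / l i.succ) * l i.succ = 2 * q i.succ := by rw [mul_assoc, hal]
    rw [hal, e]
    congr 1
    ring
  · intro i
    rw [mul_comm, hal]
    linarith [(hq i.succ).2]
  · intro i
    have h1 := hq1 i.succ
    have h2 := hl i.succ
    have h3 := hq2 i.succ
    simp only
    positivity

namespace IsKyleSolution

variable {p} {lam : Fin N → ℝ} {Sig alp : Fin (N + 1) → ℝ} {β : EuclideanSpace ℝ (Fin N)}

lemma Sig_pos (h : p.IsKyleSolution lam Sig alp β) (n : Fin (N + 1)) : 0 < Sig n := by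
  have hΔ := p.Δ_pos
  have hσ := p.σ_pos
  induction n using Fin.induction with
  | zero => rw [h.Sig_zero]; exact p.V₀_pos
  | succ i ih => rw [h.Sig_succ]; positivity

lemma lam_pos (h : p.IsKyleSolution lam Sig alp β) (i : Fin N) : 0 < lam i := by
  have hΔ := p.Δ_pos
  have hσ := p.σ_pos
  have := h.Sig_pos i.castSucc
  have := h.β_pos i
  rw [h.lam_eq]
  positivity

lemma one_sub_pos (h : p.IsKyleSolution lam Sig alp β) (i : Fin N) :
    0 < 1 - alp i.succ * lam i := by
  have := h.second_order i
  linarith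

lemma beta_mul (h : p.IsKyleSolution lam Sig alp β) (i : Fin N) :
    β i * (p.Δ * 2 * lam i * (1 - alp i.succ * lam i)) = 1 - 2 * alp i.succ * lam i := by
  have h1 := h.one_sub_pos i
  have h2 := h.lam_pos i
  have hΔ := p.Δ_pos
  rw [h.β_eq i, div_mul_cancel₀]
  positivity

lemma ratio_lt (h : p.IsKyleSolution lam Sig alp β) (i : Fin N) :
    alp i.succ * lam i < 1 / 2 := by
  have h1 := h.one_sub_pos i
  have h2 := h.lam_pos i
  have h3 := h.β_pos i
  have hΔ := p.Δ_pos
  have h4 : 0 < β i * (p.Δ * 2 * lam i * (1 - alp i.succ * lam i)) := by positivity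
  rw [h.beta_mul] at h4
  linarith

/-- With `D` the left side and `x` the ratio, `lam_eq` gives `D - σ² = Δ β λ D`, and `beta_mul`
turns this into `2 (1 - x) (D - σ²) = (1 - 2x) D`. -/
lemma denom_eq (h : p.IsKyleSolution lam Sig alp β) (i : Fin N) :
    β i ^ 2 * Sig i.castSucc * p.Δ + p.σ ^ 2 = 2 * (1 - alp i.succ * lam i) * p.σ ^ 2 := by
  have hΔ := p.Δ_pos
  have hσ := p.σ_pos
  have hS := h.Sig_pos i.castSucc
  have hD : 0 < β i ^ 2 * Sig i.castSucc * p.Δ + p.σ ^ 2 := by positivity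
  have h1 := h.beta_mul i
  have h2 := h.lam_eq i
  rw [eq_div_iff hD.ne'] at h2
  linear_combination (β i ^ 2 * Sig i.castSucc * p.Δ + p.σ ^ 2) * h1 -
    (2 * β i * p.Δ * (1 - alp i.succ * lam i)) * h2

lemma Sig_castSucc (h : p.IsKyleSolution lam Sig alp β) (i : Fin N) :
    Sig i.castSucc = 2 * (1 - alp i.succ * lam i) * Sig i.succ := by
  have h1 := (h.one_sub_pos i).ne'
  have hσ := p.σ_pos
  rw [h.Sig_succ, h.denom_eq]
  field_simp

lemma lam_sq (h : p.IsKyleSolution lam Sig alp β) (i : Fin N) :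
    lam i ^ 2 * (4 * (1 - alp i.succ * lam i) ^ 2 * (p.Δ * p.σ ^ 2)) =
      (1 - 2 * (alp i.succ * lam i)) * Sig i.castSucc := by
  have h1 := h.one_sub_pos i
  have hσ := p.σ_pos
  have h2 := h.lam_eq i
  rw [h.denom_eq, eq_div_iff (by positivity)] at h2
  linear_combination (lam i * 2 * (1 - alp i.succ * lam i) * p.Δ) * h2 +
    Sig i.castSucc * h.beta_mul i

lemma alp_nonneg (h : p.IsKyleSolution lam Sig alp β) (n : Fin (N + 1)) : 0 ≤ alp n := by
  induction n using Fin.lastCases with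
  | last => exact h.alp_last.ge
  | cast i =>
    have h1 := h.one_sub_pos i
    have h2 := h.lam_pos i
    rw [h.alp_castSucc]
    positivity

/-- Compare `lam_sq` at two consecutive times: `Σ` cancels by `Sig_castSucc`, and the recursion for
`α` expresses the quotient of the two `λ` through the ratios. -/
lemma ratio_cubic (h : p.IsKyleSolution lam Sig alp β) {i j : Fin N}
    (hij : i.succ = j.castSucc) :
    8 * (alp i.succ * lam i) ^ 2 * (1 - 2 * (alp j.succ * lam j)) * (1 - alp i.succ * lam i) =
      1 - 2 * (alp i.succ * lam i) := by
  have hΔ := p.Δ_pos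
  have hσ := p.σ_pos
  have hx := h.one_sub_pos i
  have hy := h.one_sub_pos j
  have hli := h.lam_pos i
  have hlj := h.lam_pos j
  have e1 := h.lam_sq i
  have e2 := h.lam_sq j
  have hS := h.Sig_pos j.castSucc
  rw [h.Sig_castSucc i, hij] at e1
  have e3 : 4 * (alp i.succ * lam i) * (1 - alp j.succ * lam j) * lam j = lam i := by
    rw [hij, h.alp_castSucc j]
    have hy' := hy.ne'
    generalize 1 - alp j.succ * lam j = z at hy'
    field_simp
  rw [hij] at hx e3 ⊢
  set x := alp j.castSucc * lam i
  set y := alp j.succ * lam j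
  have hne : 2 * (1 - x) * Sig j.castSucc ≠ 0 := by positivity
  refine mul_right_cancel₀ hne ?_
  rw [← e3] at e1
  linear_combination e1 - 16 * x ^ 2 * (1 - x) ^ 2 * e2

lemma ratio_unique {lam' : Fin N → ℝ} {Sig' alp' : Fin (N + 1) → ℝ}
    {β' : EuclideanSpace ℝ (Fin N)} (h : p.IsKyleSolution lam Sig alp β)
    (h' : p.IsKyleSolution lam' Sig' alp' β') (i : Fin N) :
    alp i.succ * lam i = alp' i.succ * lam' i := by
  -- Making `i.succ` a variable `n` allows backward induction from `α_N = 0`.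
  suffices H : ∀ (n : Fin (N + 1)) (i : Fin N), i.succ = n →
      alp i.succ * lam i = alp' i.succ * lam' i from H _ i rfl
  intro n
  induction n using Fin.reverseInduction with
  | last =>
    intro i hi
    rw [hi, h.alp_last, h'.alp_last, zero_mul, zero_mul]
  | cast j ih =>
    intro i hi
    have hc := h.ratio_cubic hi
    have hc' := h'.ratio_cubic hi
    rw [← ih j rfl] at hc'
    have hpos : 0 < 1 - 2 * (alp j.succ * lam j) := by linarith [h.ratio_lt j]
    exact le_antisymm
      (cubic_root_le hpos (mul_nonneg (h'.alp_nonneg _) (h'.lam_pos i).le) (h.ratio_lt i) hc' hc)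
      (cubic_root_le hpos (mul_nonneg (h.alp_nonneg _) (h.lam_pos i).le) (h'.ratio_lt i) hc hc')

/-- Kyle's system determines the trading intensities. -/
theorem unique {lam' : Fin N → ℝ} {Sig' alp' : Fin (N + 1) → ℝ}
    {β' : EuclideanSpace ℝ (Fin N)} (h : p.IsKyleSolution lam Sig alp β)
    (h' : p.IsKyleSolution lam' Sig' alp' β') : β = β' := by
  have hΔ := p.Δ_pos
  have hσ := p.σ_pos
  have hS : ∀ n, Sig n = Sig' n := by
    intro n
    induction n using Fin.induction with
    | zero => rw [h.Sig_zero, h'.Sig_zero]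
    | succ i ih =>
      have e := h.Sig_castSucc i
      have e' := h'.Sig_castSucc i
      have hq := h.one_sub_pos i
      rw [← h.ratio_unique h' i, ← ih, e] at e'
      exact mul_left_cancel₀ (by positivity) e'
  ext i
  have hl : lam i = lam' i := by
    have hq := h.one_sub_pos i
    refine (pow_left_inj₀ (h.lam_pos i).le (h'.lam_pos i).le two_ne_zero).1 ?_
    have e := h.lam_sq i
    have e' := h'.lam_sq i
    rw [← h.ratio_unique h' i, ← hS, ← e] at e'
    exact (mul_right_cancel₀ (by positivity) e').symm
  have e := h.beta_mul i
  have e' := h'.beta_mul i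
  have hq := h.one_sub_pos i
  have hlp := h.lam_pos i
  have hr := h.ratio_unique h' i
  rw [mul_assoc 2, ← hr, ← hl, ← mul_assoc 2, ← e] at e'
  exact (mul_right_cancel₀ (by positivity) e').symm

end IsKyleSolution

end KyleParams

/-- If nearby distinct points with the same image occur arbitrarily close to `a`, then the strict
derivative at `a` is not injective. -/
lemma HasStrictFDerivAt.not_injective_of_collision {E ι : Type*} [NormedAddCommGroup E]
    [NormedSpace ℝ E] [FiniteDimensional ℝ E] {f : E → E} {A : E →L[ℝ] E} {a : E}
    (hf : HasStrictFDerivAt f A a) {l : Filter ι} [l.NeBot] {u v : ι → E}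
    (hu : Tendsto u l (𝓝 a)) (hv : Tendsto v l (𝓝 a)) (hne : ∀ᶠ c in l, u c ≠ v c)
    (hfe : ∀ᶠ c in l, f (u c) = f (v c)) : ¬ Function.Injective A := by
  intro hA
  -- An injective `A` is bounded below by `1 / K`; strict differentiability with constant `1 / (2 *
  -- K)` then makes a colliding pair satisfy `‖u - v‖ ≤ ‖u - v‖ / 2`.
  obtain ⟨K, hK, hAK⟩ := LinearMap.exists_antilipschitzWith A.toLinearMap
    (LinearMap.ker_eq_bot.2 hA)
  have hK' : (0 : ℝ) < K := hK
  have huv : Tendsto (fun c => (u c, v c)) l (𝓝 (a, a)) := hu.prodMk_nhds hv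
  obtain ⟨c, h1, h2, h3⟩ := ((huv.eventually (hf.isLittleO.def
    (show (0 : ℝ) < 1 / (2 * K) by positivity))).and (hne.and hfe)).exists
  simp only [h3, sub_self, zero_sub, norm_neg] at h1
  have h4 : ‖u c - v c‖ ≤ K * ‖A (u c - v c)‖ := by
    have := hAK.le_mul_dist (u c) (v c)
    rw [dist_eq_norm, dist_eq_norm] at this
    rw [map_sub]
    exact this
  have h5 : 0 < ‖u c - v c‖ := norm_pos_iff.2 (sub_ne_zero.2 h2)
  have h6 : K * ‖A (u c - v c)‖ ≤ K * (1 / (2 * K) * ‖u c - v c‖) :=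
    mul_le_mul_of_nonneg_left h1 hK'.le
  have h7 : (K : ℝ) * (1 / (2 * K) * ‖u c - v c‖) = ‖u c - v c‖ / 2 := by field_simp
  linarith

/-! ### Smoothness of the policy map and its collisions at the equilibrium -/

namespace KyleParams

variable (p : KyleParams) {N : ℕ}

lemma condVar_zero (β : EuclideanSpace ℝ (Fin N)) : p.condVar β 0 = p.V₀ := rfl

lemma condVar_succ (β : EuclideanSpace ℝ (Fin N)) (i : Fin N) :
    p.condVar β i.succ = p.condVar β i.castSucc * p.σ ^ 2 /
      (β i ^ 2 * p.condVar β i.castSucc * p.Δ + p.σ ^ 2) :=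
  Fin.induction_succ ..

lemma alpha_last (β : EuclideanSpace ℝ (Fin N)) : p.alpha β (Fin.last N) = 0 :=
  Fin.reverseInduction_last ..

lemma alpha_castSucc (β : EuclideanSpace ℝ (Fin N)) (i : Fin N) :
    p.alpha β i.castSucc =
      1 / (4 * p.kyleLambda β i * (1 - p.alpha β i.succ * p.kyleLambda β i)) :=
  Fin.reverseInduction_castSucc ..

lemma condVar_pos (β : EuclideanSpace ℝ (Fin N)) (n : Fin (N + 1)) : 0 < p.condVar β n := by
  have hΔ := p.Δ_pos
  have hσ := p.σ_pos
  induction n using Fin.induction with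
  | zero => exact p.V₀_pos
  | succ i ih => rw [condVar_succ]; positivity

lemma denom_pos (β : EuclideanSpace ℝ (Fin N)) (i : Fin N) :
    0 < β i ^ 2 * p.condVar β i.castSucc * p.Δ + p.σ ^ 2 := by
  have hΔ := p.Δ_pos
  have hσ := p.σ_pos
  have := p.condVar_pos β i.castSucc
  positivity

/-- Only trades up to time `n` affect `Σ_n`, so changing the last intensity leaves every `Σ`
occurring in `kyleLambda` unchanged. -/
lemma condVar_congr {β γ : EuclideanSpace ℝ (Fin N)} (n : Fin (N + 1))
    (h : ∀ j : Fin N, j.castSucc < n → β j = γ j) : p.condVar β n = p.condVar γ n := by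
  induction n using Fin.induction with
  | zero => rfl
  | succ i ih =>
    rw [condVar_succ, condVar_succ, h i i.castSucc_lt_succ,
      ih fun j hj => h j (hj.trans i.castSucc_lt_succ)]

lemma T_congr {β γ : EuclideanSpace ℝ (Fin N)} (h : p.kyleLambda β = p.kyleLambda γ) :
    p.T β = p.T γ := by
  have ha : p.alpha β = p.alpha γ := by unfold alpha; rw [h]
  unfold T
  rw [h, ha]

lemma contDiff_condVar (n : Fin (N + 1)) :
    ContDiff ℝ 1 fun β : EuclideanSpace ℝ (Fin N) => p.condVar β n := by
  induction n using Fin.induction with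
  | zero => exact contDiff_const
  | succ i ih =>
    simp only [condVar_succ]
    have hi : ContDiff ℝ 1 fun β : EuclideanSpace ℝ (Fin N) => β i := by fun_prop
    exact (ih.mul contDiff_const).div ((((hi.pow 2).mul ih).mul contDiff_const).add contDiff_const)
      fun β => (p.denom_pos β i).ne'

lemma contDiff_kyleLambda (i : Fin N) :
    ContDiff ℝ 1 fun β : EuclideanSpace ℝ (Fin N) => p.kyleLambda β i := by
  have hi : ContDiff ℝ 1 fun β : EuclideanSpace ℝ (Fin N) => β i := by fun_prop
  have hc := p.contDiff_condVar i.castSucc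
  exact (hi.mul hc).div ((((hi.pow 2).mul hc).mul contDiff_const).add contDiff_const)
    fun β => (p.denom_pos β i).ne'

variable {p}

lemma contDiffAt_alpha {β : EuclideanSpace ℝ (Fin N)} (hβ : β ∈ p.dom N) (n : Fin (N + 1)) :
    ContDiffAt ℝ 1 (fun β => p.alpha β n) β := by
  induction n using Fin.reverseInduction with
  | last =>
    simp only [alpha_last]
    exact contDiffAt_const
  | cast i ih =>
    simp only [alpha_castSucc]
    have hl := (p.contDiff_kyleLambda i).contDiffAt (x := β)
    exact contDiffAt_const.div ((contDiffAt_const.mul hl).mul (contDiffAt_const.sub (ih.mul hl)))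
      (mul_ne_zero (mul_ne_zero four_ne_zero (hβ i).1) (hβ i).2)

lemma contDiffAt_T {β : EuclideanSpace ℝ (Fin N)} (hβ : β ∈ p.dom N) :
    ContDiffAt ℝ 1 p.T β := by
  rw [contDiffAt_euclidean]
  intro i
  have hl := (p.contDiff_kyleLambda i).contDiffAt (x := β)
  have ha := contDiffAt_alpha hβ i.succ
  exact (contDiffAt_const.sub ((contDiffAt_const.mul ha).mul hl)).div
    ((contDiffAt_const.mul hl).mul (contDiffAt_const.sub (ha.mul hl)))
    (mul_ne_zero (mul_ne_zero (mul_ne_zero p.Δ_pos.ne' two_ne_zero) (hβ i).1) (hβ i).2)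

lemma dom_mem_nhds {β : EuclideanSpace ℝ (Fin N)} (hβ : β ∈ p.dom N) : p.dom N ∈ 𝓝 β := by
  change ∀ᶠ γ in 𝓝 β, ∀ i : Fin N, p.kyleLambda γ i ≠ 0 ∧
    1 - p.alpha γ i.succ * p.kyleLambda γ i ≠ 0
  rw [eventually_all]
  intro i
  have hl := (p.contDiff_kyleLambda i).continuous.continuousAt (x := β)
  have ha := (contDiffAt_alpha hβ i.succ).continuousAt
  exact (hl.eventually_ne (hβ i).1).and
    ((continuousAt_const.sub (ha.mul hl)).eventually_ne (hβ i).2)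

namespace IsKyleSolution

variable {lam : Fin N → ℝ} {Sig alp : Fin (N + 1) → ℝ} {β : EuclideanSpace ℝ (Fin N)}

lemma condVar_eq (h : p.IsKyleSolution lam Sig alp β) (n : Fin (N + 1)) :
    p.condVar β n = Sig n := by
  induction n using Fin.induction with
  | zero => exact h.Sig_zero.symm
  | succ i ih => rw [condVar_succ, h.Sig_succ, ih]

lemma kyleLambda_eq (h : p.IsKyleSolution lam Sig alp β) (i : Fin N) :
    p.kyleLambda β i = lam i := by
  rw [kyleLambda, h.lam_eq, h.condVar_eq]

lemma alpha_eq (h : p.IsKyleSolution lam Sig alp β) (n : Fin (N + 1)) :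
    p.alpha β n = alp n := by
  induction n using Fin.reverseInduction with
  | last => rw [alpha_last, h.alp_last]
  | cast i ih => rw [alpha_castSucc, h.alp_castSucc, ih, h.kyleLambda_eq]

lemma mem_dom (h : p.IsKyleSolution lam Sig alp β) : β ∈ p.dom N := by
  intro i
  rw [h.kyleLambda_eq, h.alpha_eq]
  exact ⟨(h.lam_pos i).ne', (h.one_sub_pos i).ne'⟩

lemma T_eq (h : p.IsKyleSolution lam Sig alp β) : p.T β = β := by
  ext i
  rw [h.β_eq i, T]
  simp only [h.kyleLambda_eq, h.alpha_eq]

end IsKyleSolution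

/-- The last price coefficient is maximal at the equilibrium value of the last trading intensity;
multiplying or dividing the latter by `c` has the same effect on the prices. -/
lemma IsKyleSolution.T_scale_last {M : ℕ} {lam : Fin (M + 1) → ℝ} {Sig alp : Fin (M + 2) → ℝ}
    {β : EuclideanSpace ℝ (Fin (M + 1))} (h : p.IsKyleSolution lam Sig alp β) {c : ℝ}
    (hc : c ≠ 0) :
    p.T (WithLp.toLp 2 (Function.update β (Fin.last M) (c * β (Fin.last M)))) =
      p.T (WithLp.toLp 2 (Function.update β (Fin.last M) (c⁻¹ * β (Fin.last M)))) := by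
  have hS : ∀ (y : ℝ) (i : Fin (M + 1)),
      p.condVar (WithLp.toLp 2 (Function.update β (Fin.last M) y)) i.castSucc =
        Sig i.castSucc := by
    intro y i
    rw [← h.condVar_eq]
    refine p.condVar_congr _ fun j hj => ?_
    have hj' : j ≠ Fin.last M :=
      ((Fin.castSucc_lt_castSucc_iff.1 hj).trans_le (Fin.le_last i)).ne
    simp [Function.update_of_ne hj']
  refine p.T_congr (funext fun i => ?_)
  rw [kyleLambda, kyleLambda, hS, hS]
  by_cases hi : i = Fin.last M
  · subst hi
    have hσ := p.σ_pos
    have hd := h.denom_eq (Fin.last M)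
    have h0 : alp (Fin.last M).succ = 0 := h.alp_last
    rw [h0] at hd
    -- Because `α_N = 0`, both terms of the denominator agree at equilibrium. After scaling by `c`,
    -- `λ_N` is proportional to `c / (c ^ 2 + 1)`, which is invariant under `c ↦ c⁻¹`.
    have hb : β (Fin.last M) ^ 2 * Sig (Fin.last M).castSucc * p.Δ = p.σ ^ 2 := by linarith
    simp only [Function.update_self]
    have e : ∀ y, (y * β (Fin.last M)) ^ 2 * Sig (Fin.last M).castSucc * p.Δ + p.σ ^ 2 =
        (y ^ 2 + 1) * p.σ ^ 2 := fun y => by linear_combination y ^ 2 * hb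
    rw [e, e]
    have : c ^ 2 + 1 ≠ 0 := by positivity
    have : (c⁻¹) ^ 2 + 1 ≠ 0 := by positivity
    rw [div_eq_div_iff (by positivity) (by positivity)]
    field_simp
    ring
  · simp only [Function.update_of_ne hi]

/-- As `c` decreases to `1`, the policies with last intensity scaled by `c` and by `c⁻¹` are
distinct, tend to `β` and collide under `T`. -/
lemma IsKyleSolution.derivative_not_injective {M : ℕ} {lam : Fin (M + 1) → ℝ}
    {Sig alp : Fin (M + 2) → ℝ} {β : EuclideanSpace ℝ (Fin (M + 1))}
    (h : p.IsKyleSolution lam Sig alp β)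
    {A : EuclideanSpace ℝ (Fin (M + 1)) →L[ℝ] EuclideanSpace ℝ (Fin (M + 1))}
    (hA : HasStrictFDerivAt p.T A β) : ¬ Function.Injective A := by
  have hlim : ∀ g : ℝ → ℝ, Tendsto g (𝓝[>] 1) (𝓝 1) → Tendsto
      (fun c => WithLp.toLp 2 (Function.update β (Fin.last M) (g c * β (Fin.last M))))
      (𝓝[>] 1) (𝓝 β) := by
    intro g hg
    have h1 : Tendsto (fun c => Function.update (β : Fin (M + 1) → ℝ) (Fin.last M)
        (g c * β (Fin.last M))) (𝓝[>] 1) (𝓝 (Function.update (β : Fin (M + 1) → ℝ) (Fin.last M)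
        (1 * β (Fin.last M)))) :=
      (tendsto_const_nhds (x := (β : Fin (M + 1) → ℝ))).update (Fin.last M) (hg.mul_const _)
    rw [one_mul, Function.update_eq_self] at h1
    exact ((PiLp.continuous_toLp 2 _).tendsto _).comp h1
  have hid : Tendsto (fun c : ℝ => c) (𝓝[>] 1) (𝓝 1) := tendsto_id.mono_left nhdsWithin_le_nhds
  have hinv : Tendsto (fun c : ℝ => c⁻¹) (𝓝[>] 1) (𝓝 1) := by
    simpa using hid.inv₀ one_ne_zero
  refine hA.not_injective_of_collision (hlim _ hid) (hlim _ hinv) ?_ ?_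
  · filter_upwards [self_mem_nhdsWithin] with c hc he
    have hc1 : 1 < c := hc
    have h1 := congrArg (fun x : EuclideanSpace ℝ (Fin (M + 1)) => x (Fin.last M)) he
    simp only [Function.update_self] at h1
    have h2 := mul_right_cancel₀ (h.β_pos _).ne' h1
    have h3 := inv_lt_one_of_one_lt₀ hc1
    linarith
  · filter_upwards [self_mem_nhdsWithin] with c hc
    have hc1 : 1 < c := hc
    exact h.T_scale_last (by positivity)

/-- Arbitrarily close to Kyle's equilibrium there are other positive policies from which the policy
iterations converge to it. -/
theorem IsKyleEquilibrium.exists_iterationsConverge {M : ℕ}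
    {β : EuclideanSpace ℝ (Fin (M + 1))} (hβ : p.IsKyleEquilibrium β) {ε : ℝ} (hε : 0 < ε) :
    ∃ β₀ : EuclideanSpace ℝ (Fin (M + 1)), (∀ i, 0 < β₀ i) ∧ 0 < ‖β₀ - β‖ ∧ ‖β₀ - β‖ < ε ∧
      p.IterationsConverge β₀ β := by
  obtain ⟨lam, Sig, alp, h⟩ := hβ
  have hA := (contDiffAt_T h.mem_dom).hasStrictFDerivAt one_ne_zero
  have hpos : ∀ᶠ γ : EuclideanSpace ℝ (Fin (M + 1)) in 𝓝 β, ∀ i, 0 < γ i := by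
    rw [eventually_all]
    intro i
    have hi : Continuous fun γ : EuclideanSpace ℝ (Fin (M + 1)) => γ i := by fun_prop
    exact hi.continuousAt.eventually_const_lt (h.β_pos i)
  -- The whole orbit stays in the chosen neighbourhood, which secures membership in the domain at
  -- every step as well as positivity and `ε`-closeness of the start.
  obtain ⟨z, hz, hzU, hlim⟩ := exists_convergent_orbit_of_not_injective hA h.T_eq
    (h.derivative_not_injective hA)
    (inter_mem (inter_mem (dom_mem_nhds h.mem_dom) hpos) (Metric.ball_mem_nhds β hε))
  exact ⟨z, (hzU 0).1.2, norm_pos_iff.2 (sub_ne_zero.2 hz), mem_ball_iff_norm.1 (hzU 0).2,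
    fun m => (hzU m).1.1, hlim⟩

end KyleParams

/-- For `N ≥ 3` and all parameters, Kyle's equilibrium exists, is unique, and is not unstable with
respect to policy iterations for the insider; a starting policy that witnesses this can be taken
as close to the equilibrium as desired (starting policies being marginal perturbations of it). -/
theorem theorem5p3 (p : KyleParams) (N : ℕ) (hN : 3 ≤ N) :
    (∃! βhat : EuclideanSpace ℝ (Fin N), p.IsKyleEquilibrium βhat) ∧
    ∀ βhat : EuclideanSpace ℝ (Fin N), p.IsKyleEquilibrium βhat →
      ¬ p.IsUnstable βhat ∧
      ∀ ε : ℝ, 0 < ε → ∃ β₀ : EuclideanSpace ℝ (Fin N),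
        (∀ i, 0 < β₀ i) ∧ 0 < ‖β₀ - βhat‖ ∧ ‖β₀ - βhat‖ < ε ∧
          p.IterationsConverge β₀ βhat := by
  obtain ⟨M, rfl⟩ : ∃ M, N = M + 1 := ⟨N - 1, by omega⟩
  constructor
  · obtain ⟨β, hβ⟩ := p.exists_isKyleEquilibrium (M + 1)
    refine ⟨β, hβ, fun γ hγ => ?_⟩
    obtain ⟨_, _, _, h⟩ := hβ
    obtain ⟨_, _, _, h'⟩ := hγ
    exact h'.unique h
  · intro β hβ
    refine ⟨fun hun => ?_, fun ε hε => hβ.exists_iterationsConverge hε⟩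
    obtain ⟨β₀, hpos, hne, _, hconv⟩ := hβ.exists_iterationsConverge one_pos
    exact norm_pos_iff.1 hne (sub_eq_zero.2 (hun β₀ hpos hconv))
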